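/- An infinite word is a sequence $w\in A^{\mathbb N}$ over some finite alphabet $A=\{0,\dots,q-1\}$, where $q$ is not fixed and may depend on the word. Let $p_w(n)$ be the number of distinct factors of length $n$ of $w$ and $E(w)=\lim_{n\to\infty}\frac1n\log p_w(n)$ (the limit exists). For $f:\mathbb N\to\mathbb R^+$, where $\mathbb N=\{0,1,2,\dots\}$ and $\mathbb R^+=[0,+\infty)$, let $W(f)$ be the set of all infinite words $w$, over any finite alphabet, with $p_w(n)\le f(n)$ for all $n\in\mathbb N$, and let $E_W(f)=\sup_{w\in W(f)}E(w)$ (with $\sup\emptyset=-\infty$). We say that $f$ satisfies $(\mathcal C^*)$ if $f(n+1)>f(n)\ge n+1$ for all $n\in\mathbb N$ and $f(n+n')\le f(n)f(n')$ for all $n,n'\in\mathbb N$. Proposition 9.2. The following two statements are equivalent. $(P_1)$ For all functions $f,g:\mathbb N\to\mathbb R^+$ satisfying $(\mathcal C^*)$, $E_W(\min\{f,g\})=\min\{E_W(f),E_W(g)\}$. $(P_2)$ For every $h\in(0,+\infty)$ there is a function $f_h:\mathbb N\to\mathbb R^+$ satisfying $(\mathcal C^*)$ with $E_W(f_h)=h$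 and such that every function $f:\mathbb N\to\mathbb R^+$ with $E_W(f)\ge h$ satisfies $f(n)\ge f_h(n)$ for every positive integer $n$. Moreover, if $(P_1)$ or $(P_2)$ is true, then for every $h\in(0,+\infty)$ and every function $f_h$ as in $(P_2)$ there is an infinite word $w$ such that $p_w(n)=f_h(n)$ for every positive integer $n$. -/

import Mathlib

open scoped NNReal

namespace WordEntropy

/-- The set `L_n(w)` of the factors of length `n` of the infinite word `w`. -/
def factors {A : Type*} (w : ℕ → A) (n : ℕ) : Set (Fin n → A) :=
  Set.range fun (i : ℕ) (k : Fin n) => w (i + k)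

/-- The complexity function `p_w`. It is used for words over the finite alphabets `Fin q` only,
so the set of factors of a given length is finite. -/
noncomputable def complexity {A : Type*} (w : ℕ → A) (n : ℕ) : ℕ :=
  (factors w n).ncard

/-- The entropy `E(w) = lim (1/n) log p_w(n)`. The limit exists over a finite alphabet: see
`tendsto_entropy`. -/
noncomputable def entropy {A : Type*} (w : ℕ → A) : ℝ :=
  Filter.limUnder Filter.atTop fun n : ℕ => Real.log (complexity w n) / n

theorem complexity_pos {q : ℕ} (w : ℕ → Fin q) (n : ℕ) : 0 < complexity w n :=
  (Set.ncard_pos (Set.toFinite _)).2 (Set.range_nonempty _)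

theorem complexity_add_le {q : ℕ} (w : ℕ → Fin q) (m n : ℕ) :
    complexity w (m + n) ≤ complexity w m * complexity w n := by
  unfold complexity
  rw [← Set.ncard_prod]
  refine Set.ncard_le_ncard_of_injOn
    (fun v => (fun k => v (Fin.castAdd n k), fun k => v (Fin.natAdd m k))) ?_ ?_ (Set.toFinite _)
  · rintro v ⟨i, rfl⟩
    refine ⟨⟨i, ?_⟩, ⟨i + m, ?_⟩⟩
    · funext k
      simp
    · funext k
      simp [add_assoc]
  · intro u _ v _ h
    simp only [Prod.mk.injEq] at h
    funext k
    refine Fin.addCases (fun j => ?_) (fun j => ?_) k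
    · exact congrFun h.1 j
    · exact congrFun h.2 j

/-- The limit that defines the entropy of a word exists. -/
theorem tendsto_entropy {q : ℕ} (w : ℕ → Fin q) :
    Filter.Tendsto (fun n : ℕ => Real.log (complexity w n) / n) Filter.atTop
      (nhds (entropy w)) := by
  have hsub : Subadditive fun n : ℕ => Real.log (complexity w n) := by
    intro m n
    have hm : (complexity w m : ℝ) ≠ 0 := by exact_mod_cast (complexity_pos w m).ne'
    have hn : (complexity w n : ℝ) ≠ 0 := by exact_mod_cast (complexity_pos w n).ne'
    rw [← Real.log_mul hm hn]
    refine Real.log_le_log (by exact_mod_cast complexity_pos w (m + n)) ?_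
    exact_mod_cast complexity_add_le w m n
  refine tendsto_nhds_limUnder ⟨hsub.lim, hsub.tendsto_lim ⟨0, ?_⟩⟩
  rintro x ⟨n, rfl⟩
  exact div_nonneg (Real.log_natCast_nonneg _) n.cast_nonneg

/-- The set `W(f)` of the infinite words over the alphabet `{0, …, q - 1}` whose complexity
function is bounded by `f`. -/
def boundedWords (q : ℕ) (f : ℕ → ℝ≥0) : Set (ℕ → Fin q) :=
  {w | ∀ n, (complexity w n : ℝ≥0) ≤ f n}

/-- The word entropy `E_W(f)`: the supremum of `E(w)` over all infinite words `w`, on any finite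
alphabet, with `p_w ≤ f`. It is `⊥` if there is no such word. -/
noncomputable def wordEntropy (f : ℕ → ℝ≥0) : EReal :=
  ⨆ (q : ℕ) (w ∈ boundedWords q f), (entropy w : EReal)

/-- The conditions `(C*)`. -/
structure CStar (f : ℕ → ℝ≥0) : Prop where
  lt_succ : ∀ n, f n < f (n + 1)
  succ_le : ∀ n : ℕ, (n : ℝ≥0) + 1 ≤ f n
  submul : ∀ m n, f (m + n) ≤ f m * f n

/-- The word entropy of a minimum is the minimum of the word entropies. -/
def PropertyOne : Prop :=
  ∀ f g : ℕ → ℝ≥0, CStar f → CStar g →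
    wordEntropy (fun n => min (f n) (g n)) = min (wordEntropy f) (wordEntropy g)

/-- `f₀` satisfies `(C*)`, has word entropy `h`, and is a lower bound, at the positive integers, of
every function whose word entropy is at least `h`. -/
structure IsLeastOfEntropy (h : ℝ) (f₀ : ℕ → ℝ≥0) : Prop where
  cstar : CStar f₀
  entropy_eq : wordEntropy f₀ = (h : EReal)
  le : ∀ f : ℕ → ℝ≥0, (h : EReal) ≤ wordEntropy f → ∀ n, 1 ≤ n → f₀ n ≤ f n

/-- Every `h > 0` has a least function of word entropy `h`. -/
def PropertyTwo : Prop :=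
  ∀ h : ℝ, 0 < h → ∃ f₀ : ℕ → ℝ≥0, IsLeastOfEntropy h f₀

end WordEntropy

/-! The key fact is compactness (`exists_mem_boundedWords_of_forall`): the supremum in `wordEntropy
f` is attained, and a bound that can be met up to every finite length can be met everywhere. By
Fekete, entropy at least `h` means `exp h ^ n ≤ p_w(n)` for every `n`, a condition that passes to
limits of languages. A limit of languages need not come from a word, but by Zorn it contains a
minimal factorial language with this growth. Minimality forces irreducibility
(`exists_append_mem_of_minimal`), and an irreducible language is that of an infinite word
(`exists_language_eq`).

Given (P₂), for `0 < h < min (E_W f) (E_W g)`, the function `f_h` lies below both `f` and `g`, so a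
word bounded by `f_h` is bounded by `min f g`.

Given (P₁), let `leastComplexity h n` be the least `p_w(n)` over words of entropy at least `h`.
Applying (P₁) to complexity functions, which satisfy `CStar` by Morse–Hedlund, yields words
attaining these minima up to any length, and compactness yields one attaining them all. Its
complexity is `f_h`; its word entropy is not above `h` because entropies are dense
(`exists_entropy_near`). -/

namespace WordEntropy

/-! ### Factorial languages and avoided words. -/

section Language

variable {A : Type*}

/-- The words of length `n` of a language. -/
def wordsOfLength (F : Set (List A)) (n : ℕ) : Set (List A) :=
  {u | u ∈ F ∧ u.length = n}

/-- A language is factorial if it contains the factors of its words. -/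
def IsFactorial (F : Set (List A)) : Prop :=
  ∀ ⦃u v⦄, v ∈ F → u <:+: v → u ∈ F

/-- The words of `F` in which `v` does not occur. -/
def avoiding (F : Set (List A)) (v : List A) : Set (List A) :=
  {u | u ∈ F ∧ ¬ v <:+: u}

/-- The language of an infinite word. -/
def language (w : ℕ → A) : Set (List A) :=
  {u | ∃ i n : ℕ, u = List.ofFn fun k : Fin n => w (i + k)}

theorem wordsOfLength_language (w : ℕ → A) (n : ℕ) :
    wordsOfLength (language w) n = List.ofFn '' factors w n := by
  ext u
  constructor
  · rintro ⟨⟨i, m, rfl⟩, h⟩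
    rw [List.length_ofFn] at h
    subst h
    exact ⟨_, ⟨i, rfl⟩, rfl⟩
  · rintro ⟨_, ⟨i, rfl⟩, rfl⟩
    exact ⟨⟨i, n, rfl⟩, List.length_ofFn⟩

theorem ncard_wordsOfLength_language (w : ℕ → A) (n : ℕ) :
    (wordsOfLength (language w) n).ncard = complexity w n := by
  rw [wordsOfLength_language, complexity]
  exact Set.ncard_image_of_injective _ List.ofFn_injective

theorem isFactorial_language (w : ℕ → A) : IsFactorial (language w) := by
  rintro u v ⟨i, n, rfl⟩ ⟨s, t, h⟩
  refine ⟨i + s.length, u.length, ?_⟩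
  have hn : s.length + u.length + t.length = n := by
    have := congrArg List.length h
    simpa [add_assoc] using this
  apply List.ext_getElem
  · simp
  · intro k h1 h2
    have h3 : (s ++ u ++ t)[s.length + k]? = some u[k] := by
      rw [List.append_assoc, List.getElem?_append_right (by omega),
        List.getElem?_append_left (by omega)]
      simp [h1]
    rw [h, List.getElem?_eq_getElem (by simp; omega)] at h3
    simp only [List.getElem_ofFn, Option.some.injEq] at h3 ⊢
    rw [← h3, add_assoc]

theorem IsFactorial.avoiding {F : Set (List A)} (hF : IsFactorial F) (v : List A) :
    IsFactorial (avoiding F v) :=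
  fun _ _ hx hu => ⟨hF hx.1 hu, fun h => hx.2 (h.trans hu)⟩

/-- Here `s ++ [c]` is the shortest prefix of `x` that contains `u`. -/
theorem exists_append_of_isInfix {u : List A} (hu : u ≠ []) (x : List A) :
    u <:+: x → ∃ s c t, x = s ++ c :: t ∧ ¬ u <:+: s ∧ u <:+: s ++ [c] := by
  induction x using List.reverseRecOn with
  | nil =>
    intro h
    exact absurd (List.infix_nil.1 h) hu
  | append_singleton x c ih =>
    intro h
    by_cases hx : u <:+: x
    · obtain ⟨s, d, t, rfl, h1, h2⟩ := ih hx
      exact ⟨s, d, t ++ [c], by simp, h1, h2⟩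
    · exact ⟨x, c, [], rfl, hx, h⟩

variable [Finite A]

theorem finite_wordsOfLength (F : Set (List A)) (n : ℕ) : (wordsOfLength F n).Finite :=
  (List.finite_length_eq A n).subset fun _ h => h.2

theorem IsFactorial.ncard_add_le {F : Set (List A)} (hF : IsFactorial F) (m n : ℕ) :
    (wordsOfLength F (m + n)).ncard ≤
      (wordsOfLength F m).ncard * (wordsOfLength F n).ncard := by
  rw [← Set.ncard_prod]
  refine Set.ncard_le_ncard_of_injOn (fun u => (u.take m, u.drop m)) ?_ ?_
    ((finite_wordsOfLength F m).prod (finite_wordsOfLength F n))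
  · rintro u ⟨hu, hl⟩
    exact ⟨⟨hF hu (List.take_prefix m u).isInfix, by simp [hl]⟩,
      ⟨hF hu (List.drop_suffix m u).isInfix, by simp [hl]⟩⟩
  · intro u _ v _ h
    simp only [Prod.mk.injEq] at h
    rw [← List.take_append_drop m u, h.1, h.2, List.take_append_drop]

/-- The number of words in which `u` is never followed by `v`, bounded by means of the words that
avoid `u` and those that avoid `v`. -/
theorem IsFactorial.ncard_le_of_not_followed {F : Set (List A)} (hF : IsFactorial F)
    {u v : List A} (hu : u ≠ []) (huv : ∀ y, u ++ y ++ v ∉ F) (n : ℕ) :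
    (wordsOfLength F n).ncard ≤ (wordsOfLength (WordEntropy.avoiding F u) n).ncard +
      ∑ i ∈ Finset.range n, (wordsOfLength (WordEntropy.avoiding F u) i).ncard *
        (Nat.card A * (wordsOfLength (WordEntropy.avoiding F v) (n - 1 - i)).ncard) := by
  set T : ℕ → Set (List A) := fun i =>
    (fun p : List A × A × List A => p.1 ++ p.2.1 :: p.2.2) ''
      (wordsOfLength (WordEntropy.avoiding F u) i ×ˢ
        ((Set.univ : Set A) ×ˢ wordsOfLength (WordEntropy.avoiding F v) (n - 1 - i))) with hT
  have hfin : ∀ i, (wordsOfLength (WordEntropy.avoiding F u) i ×ˢ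
        ((Set.univ : Set A) ×ˢ wordsOfLength (WordEntropy.avoiding F v) (n - 1 - i))).Finite :=
    fun i => (finite_wordsOfLength _ _).prod (Set.finite_univ.prod (finite_wordsOfLength _ _))
  -- Cut a word containing `u` at the letter `c` that completes the first occurrence of `u`: what
  -- precedes `c` avoids `u`, and what follows avoids `v`, since otherwise some `u ++ y ++ v` would
  -- lie in `F`.
  have hsub : wordsOfLength F n ⊆
      wordsOfLength (WordEntropy.avoiding F u) n ∪ ⋃ i ∈ Finset.range n, T i := by
    rintro x ⟨hx, hl⟩
    by_cases hux : u <:+: x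
    · right
      obtain ⟨s, c, t, rfl, h1, h2⟩ := exists_append_of_isInfix hu x hux
      simp only [List.length_append, List.length_cons] at hl
      simp only [Finset.mem_range, Set.mem_iUnion]
      refine ⟨s.length, by omega, (s, c, t), ⟨⟨⟨hF hx ⟨[], c :: t, by simp⟩, h1⟩, rfl⟩,
        trivial, ⟨⟨hF hx ⟨s ++ [c], [], by simp⟩, ?_⟩, ?_⟩⟩, rfl⟩
      · rintro ⟨a, b, rfl⟩
        obtain ⟨a', b', h2⟩ := h2
        refine huv (b' ++ a) (hF hx ⟨a', b, ?_⟩)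
        rw [List.append_cons, ← h2]
        simp
      · simp only
        omega
    · exact Or.inl ⟨⟨hx, hux⟩, hl⟩
  refine (Set.ncard_le_ncard hsub ((finite_wordsOfLength _ _).union
    ((Finset.range n).finite_toSet.biUnion fun i _ => (hfin i).image _))).trans ?_
  refine (Set.ncard_union_le _ _).trans (Nat.add_le_add_left ?_ _)
  refine (Finset.set_ncard_biUnion_le _ _).trans (Finset.sum_le_sum fun i _ => ?_)
  refine (Set.ncard_image_le (hfin i)).trans ?_
  rw [Set.ncard_prod, Set.ncard_prod, Set.ncard_univ]

end Language

/-! ### Minimal languages of given growth, and words realizing them. -/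

/-- A submultiplicative sequence that is below `a ^ n` once grows at a rate smaller than `a`. -/
theorem exists_le_mul_pow_of_submul {c : ℕ → ℕ} (hc : ∀ m n, c (m + n) ≤ c m * c n) {a : ℝ}
    (ha : 0 < a) {n₀ : ℕ} (h₀ : (c n₀ : ℝ) < a ^ n₀) :
    ∃ C r : ℝ, 0 < C ∧ 0 < r ∧ r < a ∧ ∀ n, (c n : ℝ) ≤ C * r ^ n := by
  rcases Nat.eq_zero_or_pos n₀ with rfl | hpos
  · have h0 : c 0 = 0 := by
      simpa using h₀
    refine ⟨1, a / 2, one_pos, by positivity, by linarith, fun n => ?_⟩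
    have : c n = 0 := by
      have := hc 0 n
      simpa [h0] using this
    rw [this]
    simp only [Nat.cast_zero]
    positivity
  · obtain ⟨r, ⟨hr, hr0⟩, hra⟩ : ∃ r : ℝ, ((c n₀ : ℝ) < r ^ n₀ ∧ 0 < r) ∧ r < a := by
      have h1 : ∀ᶠ r : ℝ in nhdsWithin a (Set.Iio a), (c n₀ : ℝ) < r ^ n₀ ∧ 0 < r :=
        nhdsWithin_le_nhds (((continuous_pow n₀).continuousAt.eventually_const_lt h₀).and
          (lt_mem_nhds ha))
      exact (h1.and self_mem_nhdsWithin).exists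
    -- The sum absorbs the lengths below `n₀`; longer ones reduce to these by splitting off blocks
    -- of length `n₀`.
    set C : ℝ := 1 + ∑ s ∈ Finset.range n₀, (c s : ℝ) / r ^ s with hC
    have hCpos : 0 < C := by positivity
    refine ⟨C, r, hCpos, hr0, hra, fun n => ?_⟩
    induction n using Nat.strong_induction_on with
    | _ n ih =>
      rcases lt_or_ge n n₀ with hn | hn
      · rw [← div_le_iff₀ (by positivity)]
        have := Finset.single_le_sum (f := fun s => (c s : ℝ) / r ^ s)
          (fun i _ => by positivity) (Finset.mem_range.2 hn)
        linarith
      · obtain ⟨m, rfl⟩ := Nat.exists_eq_add_of_le hn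
        calc (c (n₀ + m) : ℝ) ≤ c n₀ * c m := by exact_mod_cast hc n₀ m
          _ ≤ r ^ n₀ * (C * r ^ m) := by
            gcongr
            exact ih m (by omega)
          _ = C * r ^ (n₀ + m) := by ring

section Minimal

variable {A : Type*} [Finite A]

/-- Factorial languages with at least `a ^ n` words of every length `n`. -/
def GrowsAtLeast (a : ℝ) (F : Set (List A)) : Prop :=
  IsFactorial F ∧ ∀ n, a ^ n ≤ (wordsOfLength F n).ncard

theorem exists_minimal_growsAtLeast {a : ℝ} {F : Set (List A)} (hF : GrowsAtLeast a F) :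
    ∃ G ⊆ F, Minimal (GrowsAtLeast a) G := by
  refine zorn_superset_nonempty {F | GrowsAtLeast a F} ?_ F hF
  intro c hc hchain hne
  refine ⟨⋂₀ c, ⟨fun u v hv huv G hG => (hc hG).1 (hv G hG) huv, fun n => ?_⟩,
    fun G hG => Set.sInter_subset_of_mem hG⟩
  -- A member of the chain with fewest words of length `n` has all of them in every other member,
  -- hence in the intersection.
  obtain ⟨G, hG, hmin⟩ : ∃ G ∈ c, ∀ H ∈ c,
      (wordsOfLength G n).ncard ≤ (wordsOfLength H n).ncard := by
    obtain ⟨G, hG, hmin⟩ := WellFounded.has_min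
      (measure fun G : Set (List A) => (wordsOfLength G n).ncard).wf c hne
    exact ⟨G, hG, fun H hH => not_lt.1 (hmin H hH)⟩
  refine ((hc hG).2 n).trans ?_
  norm_cast
  refine Set.ncard_le_ncard ?_ (finite_wordsOfLength _ _)
  rintro u hu
  refine ⟨fun H hH => ?_, hu.2⟩
  rcases hchain.total hG hH with h | h
  · exact h hu.1
  · have hs : wordsOfLength H n ⊆ wordsOfLength G n := fun x hx => ⟨h hx.1, hx.2⟩
    rw [← Set.eq_of_subset_of_ncard_le hs (hmin H hH) (finite_wordsOfLength _ _)] at hu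
    exact hu.1

/-- Avoiding `v` loses `v` itself, so by minimality the growth bound fails at some length;
submultiplicativity turns this one failure into a smaller exponential rate. -/
theorem exists_avoiding_le_of_minimal {a : ℝ} (ha : 0 < a) {F : Set (List A)}
    (hF : Minimal (GrowsAtLeast a) F) {v : List A} (hv : v ∈ F) :
    ∃ C r : ℝ, 0 < C ∧ 0 < r ∧ r < a ∧
      ∀ n, ((wordsOfLength (avoiding F v) n).ncard : ℝ) ≤ C * r ^ n := by
  have h1 : ¬ GrowsAtLeast a (avoiding F v) := fun h =>
    (hF.2 h (fun _ hx => hx.1) hv).2 List.infix_rfl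
  have h2 : ∃ n, ((wordsOfLength (avoiding F v) n).ncard : ℝ) < a ^ n := by
    by_contra! h
    exact h1 ⟨hF.1.1.avoiding v, h⟩
  obtain ⟨n₀, h₀⟩ := h2
  exact exists_le_mul_pow_of_submul (fun m n => (hF.1.1.avoiding v).ncard_add_le m n) ha h₀

/-- A minimal language with a given growth is irreducible. -/
theorem exists_append_mem_of_minimal {a : ℝ} (ha : 0 < a) {F : Set (List A)}
    (hF : Minimal (GrowsAtLeast a) F) {u v : List A} (hu : u ∈ F) (hv : v ∈ F) :
    ∃ y, u ++ y ++ v ∈ F := by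
  rcases eq_or_ne u [] with rfl | hne
  · exact ⟨[], by simpa using hv⟩
  by_contra! huv
  obtain ⟨C, r, hC, hr, hra, hCr⟩ := exists_avoiding_le_of_minimal ha hF hu
  obtain ⟨D, s, hD, hs, hsa, hDs⟩ := exists_avoiding_le_of_minimal ha hF hv
  set t := max r s with ht
  have ht0 : 0 < t := lt_max_of_lt_left hr
  have hta : t < a := max_lt hra hsa
  set K : ℝ := C * (Nat.card A * D) / t with hK
  -- The exponents `i` and `n - 1 - i` add up to `n - 1`, hence the division by `t` in `K`. Since `t
  -- < a`, a linear factor `n` cannot save the bound.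
  have hbound : ∀ n : ℕ, a ^ n ≤ C * t ^ n + n * (K * t ^ n) := by
    intro n
    refine (hF.1.2 n).trans ?_
    refine (Nat.cast_le.2 (hF.1.1.ncard_le_of_not_followed hne huv n)).trans ?_
    push_cast
    refine add_le_add ((hCr n).trans ?_) ?_
    · gcongr
      exact le_max_left r s
    · refine (Finset.sum_le_card_nsmul _ _ (K * t ^ n) fun i hi => ?_).trans
        (by rw [Finset.card_range, nsmul_eq_mul])
      rw [Finset.mem_range] at hi
      calc ((wordsOfLength (avoiding F u) i).ncard : ℝ) *
            (Nat.card A * (wordsOfLength (avoiding F v) (n - 1 - i)).ncard)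
          ≤ (C * t ^ i) * (Nat.card A * (D * t ^ (n - 1 - i))) := by
            gcongr
            · refine (hCr i).trans ?_
              gcongr
              exact le_max_left r s
            · refine (hDs _).trans ?_
              gcongr
              exact le_max_right r s
        _ = K * t ^ n := by
            obtain ⟨m, rfl⟩ : ∃ m, n = i + 1 + m := Nat.exists_eq_add_of_le hi
            have : i + 1 + m - 1 - i = m := by omega
            rw [this, hK]
            field_simp
            ring
  have hx0 : 0 ≤ t / a := by positivity
  have hx1 : t / a < 1 := (div_lt_one ha).2 hta
  have hlim : Filter.Tendsto (fun n : ℕ => C * (t / a) ^ n + K * (n * (t / a) ^ n))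
      Filter.atTop (nhds (C * 0 + K * 0)) :=
    ((tendsto_pow_atTop_nhds_zero_of_lt_one hx0 hx1).const_mul C).add
      ((tendsto_self_mul_const_pow_of_lt_one hx0 hx1).const_mul K)
  have hle : (1 : ℝ) ≤ C * 0 + K * 0 := by
    refine ge_of_tendsto' hlim fun n => ?_
    have h := hbound n
    have hpos : 0 < a ^ n := by positivity
    rw [div_pow]
    calc (1 : ℝ) = a ^ n / a ^ n := (div_self hpos.ne').symm
      _ ≤ (C * t ^ n + n * (K * t ^ n)) / a ^ n := by gcongr
      _ = _ := by ring
  norm_num at hle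

/-- An irreducible factorial language with words of every length is the language of an infinite
word. -/
theorem exists_language_eq {F : Set (List A)} (hF : IsFactorial F)
    (hne : ∀ n, (wordsOfLength F n).Nonempty)
    (htrans : ∀ u ∈ F, ∀ v ∈ F, ∃ y, u ++ y ++ v ∈ F) :
    ∃ w : ℕ → A, language w = F := by
  have hcount : F.Countable := Set.to_countable F
  obtain ⟨u₀, hu₀, -⟩ := hne 0
  obtain ⟨e, he⟩ := hcount.exists_eq_range ⟨u₀, hu₀⟩
  have heF : ∀ k, e k ∈ F := fun k => he ▸ Set.mem_range_self k
  choose! y hy using htrans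
  -- Chain all words of `F` together with connecting words: the prefixes `x k` are nested, stay in
  -- `F`, and define the infinite word.
  let x : ℕ → List A := fun k => Nat.rec (e 0) (fun k z => z ++ y z (e (k + 1)) ++ e (k + 1)) k
  have hxs : ∀ k, x (k + 1) = x k ++ y (x k) (e (k + 1)) ++ e (k + 1) := fun _ => rfl
  have hxF : ∀ k, x k ∈ F := by
    intro k
    induction k with
    | zero => exact heF 0
    | succ k ih => exact hxs k ▸ hy _ ih _ (heF _)
  have hpre : ∀ {k l}, k ≤ l → x k <+: x l := by
    intro k l hkl
    induction hkl with
    | refl => exact List.prefix_rfl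
    | step _ ih => exact ih.trans ⟨_, (List.append_assoc _ _ _).symm⟩
  have hsuf : ∀ k, e k <:+ x k := by
    intro k
    cases k with
    | zero => exact List.suffix_rfl
    | succ k => exact ⟨_, rfl⟩
  have hlong : ∀ n, ∃ k, n < (x k).length := by
    intro n
    obtain ⟨u, hu, hl⟩ := hne (n + 1)
    rw [he] at hu
    obtain ⟨k, rfl⟩ := hu
    have := (hsuf k).length_le
    exact ⟨k, by omega⟩
  choose K hKlt using hlong
  let w : ℕ → A := fun n => (x (K n))[n]'(hKlt n)
  have hw : ∀ k n (h : n < (x k).length), w n = (x k)[n] := by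
    intro k n h
    rcases le_total k (K n) with hk | hk
    · exact ((hpre hk).getElem h).symm
    · exact (hpre hk).getElem (hKlt n)
  refine ⟨w, Set.Subset.antisymm ?_ ?_⟩
  · rintro _ ⟨i, n, rfl⟩
    refine hF (hxF (K (i + n))) ?_
    have hlt := hKlt (i + n)
    have : List.ofFn (fun k : Fin n => w (i + k)) = ((x (K (i + n))).drop i).take n := by
      apply List.ext_getElem
      · simp
        omega
      · intro k h1 h2
        simp only [List.length_ofFn] at h1
        simp only [List.getElem_ofFn, List.getElem_take, List.getElem_drop]
        exact hw _ _ _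
    rw [this]
    exact (List.take_prefix _ _).isInfix.trans (List.drop_suffix _ _).isInfix
  · intro u hu
    rw [he] at hu
    obtain ⟨k, rfl⟩ := hu
    refine isFactorial_language w ?_ (hsuf k).isInfix
    refine ⟨0, (x k).length, List.ext_getElem (by simp) fun n h1 h2 => ?_⟩
    simp [← hw k n h1]

theorem GrowsAtLeast.exists_word {a : ℝ} (ha : 0 < a) {F : Set (List A)}
    (hF : GrowsAtLeast a F) :
    ∃ w : ℕ → A, language w ⊆ F ∧ ∀ n, a ^ n ≤ complexity w n := by
  obtain ⟨G, hGF, hG⟩ := exists_minimal_growsAtLeast hF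
  have hne : ∀ n, (wordsOfLength G n).Nonempty := by
    intro n
    rw [← Set.ncard_pos (finite_wordsOfLength G n)]
    have : (0 : ℝ) < (wordsOfLength G n).ncard := (pow_pos ha n).trans_le (hG.1.2 n)
    exact_mod_cast this
  obtain ⟨w, rfl⟩ := exists_language_eq hG.1.1 hne fun u hu v hv =>
    exists_append_mem_of_minimal ha hG hu hv
  refine ⟨w, hGF, fun n => ?_⟩
  rw [← ncard_wordsOfLength_language]
  exact hG.1.2 n

end Minimal

/-! ### Entropy and complexity of a single word. -/

theorem complexity_zero {A : Type*} (w : ℕ → A) : complexity w 0 = 1 := by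
  rw [complexity, Set.ncard_eq_one]
  exact ⟨default, Set.Subset.antisymm (fun _ _ => Subsingleton.elim _ _)
    fun x _ => ⟨0, Subsingleton.elim _ _⟩⟩

section Entropy

variable {q : ℕ} (w : ℕ → Fin q)

/-- By Fekete's lemma the limit is an infimum, so it bounds every term. -/
theorem exp_entropy_pow_le_complexity (n : ℕ) : Real.exp (entropy w) ^ n ≤ complexity w n := by
  have hpos : ∀ n, (0 : ℝ) < complexity w n := fun n => by exact_mod_cast complexity_pos w n
  have hsub : Subadditive fun n : ℕ => Real.log (complexity w n) := by
    intro m n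
    rw [← Real.log_mul (hpos m).ne' (hpos n).ne']
    refine Real.log_le_log (hpos _) ?_
    exact_mod_cast complexity_add_le w m n
  have hbdd : BddBelow (Set.range fun n : ℕ => Real.log (complexity w n) / n) := by
    refine ⟨0, ?_⟩
    rintro x ⟨n, rfl⟩
    exact div_nonneg (Real.log_natCast_nonneg _) n.cast_nonneg
  have hlim : entropy w = hsub.lim :=
    tendsto_nhds_unique (tendsto_entropy w) (hsub.tendsto_lim hbdd)
  rcases Nat.eq_zero_or_pos n with rfl | hn
  · simp [complexity_zero]
  · have h := hsub.lim_le_div hbdd hn.ne'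
    have hn' : (0 : ℝ) < n := by exact_mod_cast hn
    rw [← hlim, le_div_iff₀ hn'] at h
    rw [← Real.exp_nat_mul, ← Real.le_log_iff_exp_le (hpos n)]
    linarith

theorem le_entropy_of_exp_pow_le {h : ℝ} (hw : ∀ n, Real.exp h ^ n ≤ complexity w n) :
    h ≤ entropy w := by
  refine ge_of_tendsto (tendsto_entropy w) ?_
  filter_upwards [Filter.eventually_gt_atTop 0] with n hn
  have hn' : (0 : ℝ) < n := by exact_mod_cast hn
  rw [le_div_iff₀ hn', Real.le_log_iff_exp_le (by exact_mod_cast complexity_pos w n)]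
  have := hw n
  rwa [← Real.exp_nat_mul, mul_comm] at this

theorem entropy_nonneg : 0 ≤ entropy w :=
  ge_of_tendsto' (tendsto_entropy w) fun n =>
    div_nonneg (Real.log_natCast_nonneg _) n.cast_nonneg

theorem entropy_mono {q' : ℕ} {w : ℕ → Fin q} {w' : ℕ → Fin q'}
    (h : ∀ n, complexity w n ≤ complexity w' n) : entropy w ≤ entropy w' :=
  le_entropy_of_exp_pow_le w' fun n =>
    (exp_entropy_pow_le_complexity w n).trans (by exact_mod_cast h n)

theorem entropy_eq_zero_of_bounded {C : ℕ} (h : ∀ n, complexity w n ≤ C) : entropy w = 0 := by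
  refine le_antisymm ?_ (entropy_nonneg w)
  by_contra! hpos
  obtain ⟨n, hn⟩ := pow_unbounded_of_one_lt (C : ℝ) (Real.one_lt_exp_iff.2 hpos)
  exact absurd ((exp_entropy_pow_le_complexity w n).trans (by exact_mod_cast h n)) (not_le.2 hn)

theorem image_factors_succ (n : ℕ) :
    (fun (v : Fin (n + 1) → Fin q) (k : Fin n) => v k.castSucc) '' factors w (n + 1) =
      factors w n := by
  ext v
  constructor
  · rintro ⟨_, ⟨i, rfl⟩, rfl⟩
    exact ⟨i, rfl⟩
  · rintro ⟨i, rfl⟩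
    exact ⟨_, ⟨i, rfl⟩, rfl⟩

theorem complexity_le_succ (n : ℕ) : complexity w n ≤ complexity w (n + 1) := by
  unfold complexity
  rw [← image_factors_succ w n]
  exact Set.ncard_image_le (Set.toFinite _)

theorem complexity_mono : Monotone (complexity w) :=
  monotone_nat_of_le_succ (complexity_le_succ w)

/-- If `p_w` does not grow at `n`, each factor of length `n` extends uniquely to the right. The last
letter of a longer factor is then determined by the letters before it. -/
theorem complexity_succ_le_succ {n : ℕ} (h : complexity w (n + 1) ≤ complexity w n) :
    complexity w (n + 2) ≤ complexity w (n + 1) := by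
  have hinj : Set.InjOn (fun (v : Fin (n + 1) → Fin q) (k : Fin n) => v k.castSucc)
      (factors w (n + 1)) := by
    rw [← Set.ncard_image_iff (Set.toFinite _), image_factors_succ]
    exact le_antisymm (complexity_le_succ w n) h
  refine Set.ncard_le_ncard_of_injOn
    (fun (v : Fin (n + 1 + 1) → Fin q) (k : Fin (n + 1)) => v k.castSucc) ?_ ?_ (Set.toFinite _)
  · rintro _ ⟨i, rfl⟩
    exact ⟨i, rfl⟩
  · rintro u hu v hv huv
    have htail : ∀ z ∈ factors w (n + 1 + 1), (fun k : Fin (n + 1) => z k.succ) ∈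
        factors w (n + 1) := by
      rintro _ ⟨i, rfl⟩
      refine ⟨i + 1, ?_⟩
      funext k
      simp [add_comm, add_left_comm]
    have h1 := hinj (htail u hu) (htail v hv) (by
      funext k
      exact congrFun huv k.succ)
    funext k
    refine Fin.cases ?_ (fun j => congrFun h1 j) k
    exact congrFun huv 0

/-- Morse–Hedlund: the complexity function of a word of positive entropy increases strictly. -/
theorem complexity_lt_succ (hw : 0 < entropy w) (n : ℕ) :
    complexity w n < complexity w (n + 1) := by
  by_contra! h
  have hstep : ∀ m, complexity w (n + m + 1) ≤ complexity w (n + m) := by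
    intro m
    induction m with
    | zero => exact h
    | succ m ih => exact complexity_succ_le_succ w ih
  have hle : ∀ m, complexity w (n + m) ≤ complexity w n := by
    intro m
    induction m with
    | zero => exact le_rfl
    | succ m ih => exact (hstep m).trans ih
  refine hw.ne' (entropy_eq_zero_of_bounded w (C := complexity w n) fun m => ?_)
  exact (complexity_mono w (Nat.le_add_left m n)).trans (hle m)

theorem cstar_complexity (hw : 0 < entropy w) : CStar fun n => (complexity w n : ℝ≥0) where
  lt_succ n := by exact_mod_cast complexity_lt_succ w hw n
  succ_le n := by
    norm_cast
    induction n with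
    | zero => exact complexity_pos w 0
    | succ n ih => exact ih.trans_lt (complexity_lt_succ w hw n)
  submul m n := by exact_mod_cast complexity_add_le w m n

end Entropy

/-! ### Compactness. -/

section Compactness

theorem complexity_comp {A B : Type*} (w : ℕ → A) {e : A → B} (he : Set.InjOn e (Set.range w))
    (n : ℕ) : complexity (e ∘ w) n = complexity w n := by
  unfold complexity
  have : factors (e ∘ w) n = (fun v k => e (v k)) '' factors w n := by
    rw [factors, factors, ← Set.range_comp]
    rfl
  rw [this]
  refine Set.InjOn.ncard_image ?_
  rintro _ ⟨i, rfl⟩ _ ⟨j, rfl⟩ h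
  funext k
  exact he ⟨_, rfl⟩ ⟨_, rfl⟩ (congrFun h k)

theorem complexity_one {A : Type*} (w : ℕ → A) : complexity w 1 = (Set.range w).ncard := by
  have : Set.range w = (fun v : Fin 1 → A => v 0) '' factors w 1 := by
    rw [factors, ← Set.range_comp]
    rfl
  rw [this, complexity]
  refine (Set.ncard_image_of_injective _ fun u v h => ?_).symm
  funext k
  rw [Subsingleton.elim k 0]
  exact h

/-- A word can be written with as many letters as occur in it. -/
theorem exists_relabel {q Q : ℕ} (w : ℕ → Fin q) (hw : complexity w 1 ≤ Q) :
    ∃ w' : ℕ → Fin Q, ∀ n, complexity w' n = complexity w n := by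
  rw [complexity_one] at hw
  have hcard : Nat.card (Set.range w) ≤ Nat.card (Fin Q) := by
    rwa [Nat.card_coe_set_eq, Nat.card_fin]
  obtain ⟨e⟩ : Nonempty (Set.range w ↪ Fin Q) := by
    have := Fintype.ofFinite (Set.range w)
    rw [Nat.card_eq_fintype_card, Nat.card_eq_fintype_card] at hcard
    exact Function.Embedding.nonempty_of_card_le hcard
  have : Nonempty (Fin Q) := ⟨e ⟨w 0, 0, rfl⟩⟩
  let e' : Fin q → Fin Q := Function.extend Subtype.val e fun _ => Classical.arbitrary _
  have he' : ∀ x : Set.range w, e' x = e x := fun x =>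
    Subtype.val_injective.extend_apply _ _ x
  refine ⟨e' ∘ w, complexity_comp w ?_⟩
  intro a ha b hb h
  have : e ⟨a, ha⟩ = e ⟨b, hb⟩ := by rw [← he', ← he']; exact h
  exact congrArg Subtype.val (e.injective this)

/-- Along an ultrafilter, the words of length `n` of a sequence of languages stabilize. -/
theorem eventually_wordsOfLength_eq {A ι : Type*} [Finite A] (U : Ultrafilter ι)
    (L : ι → Set (List A)) (n : ℕ) :
    ∀ᶠ N in U, wordsOfLength (L N) n = wordsOfLength {u | ∀ᶠ M in U, u ∈ L M} n := by
  have h : ∀ u ∈ {u : List A | u.length = n},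
      ∀ᶠ N in (U : Filter ι), (u ∈ L N ↔ ∀ᶠ M in U, u ∈ L M) := by
    intro u _
    by_cases hu : ∀ᶠ M in U, u ∈ L M
    · filter_upwards [hu] with N hN
      exact ⟨fun _ => hu, fun _ => hN⟩
    · filter_upwards [Ultrafilter.eventually_not.2 hu] with N hN
      exact ⟨fun h => absurd h hN, fun h => absurd h hu⟩
  filter_upwards [(Filter.eventually_all_finite (List.finite_length_eq A n)).2 h] with N hN
  ext u
  exact ⟨fun hu => ⟨(hN u hu.2).1 hu.1, hu.2⟩, fun hu => ⟨(hN u hu.2).2 hu.1, hu.2⟩⟩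

/-- If there are words of entropy almost `h` with complexity bounded by `f` up to any given length,
then there is a word of entropy at least `h` with complexity bounded by `f`. -/
theorem exists_mem_boundedWords_of_forall {f : ℕ → ℝ≥0} {h : ℝ}
    (H : ∀ N : ℕ, ∃ (q : ℕ) (w : ℕ → Fin q),
      (∀ n ≤ N, (complexity w n : ℝ≥0) ≤ f n) ∧ h - 1 / ((N : ℝ) + 1) ≤ entropy w) :
    ∃ (q : ℕ) (w : ℕ → Fin q), w ∈ boundedWords q f ∧ h ≤ entropy w := by
  -- Since `f 1` bounds the number of letters, all words fit on one alphabet. The hypothesis is used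
  -- at `N + 1` so that length 1 is always covered.
  have H' : ∀ N : ℕ, ∃ w : ℕ → Fin ⌊f 1⌋₊,
      (∀ n ≤ N, (complexity w n : ℝ≥0) ≤ f n) ∧
        ∀ n, Real.exp (h - 1 / ((N : ℝ) + 1)) ^ n ≤ complexity w n := by
    intro N
    obtain ⟨q, w, hw, hE⟩ := H (N + 1)
    obtain ⟨w', hw'⟩ := exists_relabel w (Nat.le_floor (hw 1 (by omega)))
    refine ⟨w', fun n hn => hw' n ▸ hw n (by omega), fun n => ?_⟩
    rw [hw']
    refine le_trans ?_ (exp_entropy_pow_le_complexity w n)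
    have h1 : 1 / (((N + 1 : ℕ) : ℝ) + 1) ≤ 1 / ((N : ℝ) + 1) := by
      push_cast
      gcongr
      linarith
    gcongr
    linarith
  choose w hwf hwh using H'
  let U : Ultrafilter ℕ := Filter.hyperfilter ℕ
  have hU : (U : Filter ℕ) ≤ Filter.atTop := Nat.hyperfilter_le_atTop
  -- The ultralimit of the languages; at each length it agrees with almost all of them.
  let F : Set (List (Fin ⌊f 1⌋₊)) := {u | ∀ᶠ N in U, u ∈ language (w N)}
  have hFc : ∀ n, ∀ᶠ N in U, complexity (w N) n = (wordsOfLength F n).ncard := by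
    intro n
    filter_upwards [eventually_wordsOfLength_eq U (fun N => language (w N)) n] with N hN
    rw [← ncard_wordsOfLength_language, hN]
  have hF : GrowsAtLeast (Real.exp h) F := by
    refine ⟨fun u v hv huv => ?_, fun n => ?_⟩
    · have hv' : ∀ᶠ N in U, v ∈ language (w N) := hv
      exact hv'.mono fun N hN => isFactorial_language _ hN huv
    · have hlim : Filter.Tendsto (fun N : ℕ => Real.exp (h - 1 / ((N : ℝ) + 1)) ^ n) U
          (nhds (Real.exp (h - 0) ^ n)) :=
        (((Real.continuous_exp.tendsto _).comp
          (tendsto_one_div_add_atTop_nhds_zero_nat.const_sub h)).pow n).mono_left hU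
      rw [sub_zero] at hlim
      refine le_of_tendsto hlim ?_
      filter_upwards [hFc n] with N hN
      rw [← hN]
      exact hwh N n
  have hFf : ∀ n, ((wordsOfLength F n).ncard : ℝ≥0) ≤ f n := by
    intro n
    obtain ⟨N, hN, hn⟩ := ((hFc n).and (hU (Filter.eventually_ge_atTop n))).exists
    rw [← hN]
    exact hwf N n hn
  obtain ⟨z, hzF, hz⟩ := hF.exists_word (Real.exp_pos h)
  refine ⟨_, z, fun n => ?_, le_entropy_of_exp_pow_le z hz⟩
  refine le_trans ?_ (hFf n)
  rw [← ncard_wordsOfLength_language]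
  norm_cast
  exact Set.ncard_le_ncard (fun u hu => ⟨hzF hu.1, hu.2⟩) (finite_wordsOfLength _ _)

end Compactness

/-! ### Word entropy of a function. -/

theorem entropy_le_wordEntropy {f : ℕ → ℝ≥0} {q : ℕ} {w : ℕ → Fin q}
    (hw : w ∈ boundedWords q f) : (entropy w : EReal) ≤ wordEntropy f :=
  le_iSup_of_le q (le_iSup₂_of_le w hw le_rfl)

theorem wordEntropy_le {f : ℕ → ℝ≥0} {c : EReal}
    (h : ∀ (q : ℕ) (w : ℕ → Fin q), w ∈ boundedWords q f → (entropy w : EReal) ≤ c) :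
    wordEntropy f ≤ c :=
  iSup_le fun q => iSup₂_le fun w hw => h q w hw

theorem wordEntropy_mono {f g : ℕ → ℝ≥0} (h : ∀ n, f n ≤ g n) :
    wordEntropy f ≤ wordEntropy g :=
  wordEntropy_le fun _ _ hw => entropy_le_wordEntropy fun n => (hw n).trans (h n)

/-- The supremum that defines the word entropy is attained. -/
theorem exists_mem_boundedWords_of_le_wordEntropy {f : ℕ → ℝ≥0} {h : ℝ}
    (hf : (h : EReal) ≤ wordEntropy f) :
    ∃ (q : ℕ) (w : ℕ → Fin q), w ∈ boundedWords q f ∧ h ≤ entropy w := by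
  refine exists_mem_boundedWords_of_forall fun N => ?_
  have hlt : ((h - 1 / ((N : ℝ) + 1) : ℝ) : EReal) < wordEntropy f := by
    refine lt_of_lt_of_le (EReal.coe_lt_coe_iff.2 ?_) hf
    have : (0 : ℝ) < 1 / ((N : ℝ) + 1) := by positivity
    linarith
  simp only [wordEntropy, lt_iSup_iff] at hlt
  obtain ⟨q, w, hw, hlt⟩ := hlt
  exact ⟨q, w, fun n _ => hw n, (EReal.coe_lt_coe_iff.1 hlt).le⟩

/-! ### Density of the entropies, by repeating each letter `k` times. -/

/-- Over any nonempty finite alphabet there is an infinite word in which every finite word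
occurs. -/
theorem exists_pow_le_complexity {q : ℕ} (hq : 0 < q) :
    ∃ u : ℕ → Fin q, ∀ n, q ^ n ≤ complexity u n := by
  have hF : GrowsAtLeast (q : ℝ) (Set.univ : Set (List (Fin q))) := by
    refine ⟨fun _ _ _ _ => trivial, fun n => ?_⟩
    have : wordsOfLength (Set.univ : Set (List (Fin q))) n =
        List.ofFn '' (Set.univ : Set (Fin n → Fin q)) := by
      ext u
      constructor
      · rintro ⟨-, rfl⟩
        exact ⟨u.get, trivial, List.ofFn_get u⟩
      · rintro ⟨v, -, rfl⟩
        exact ⟨trivial, List.length_ofFn⟩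
    rw [this, Set.ncard_image_of_injective _ List.ofFn_injective, Set.ncard_univ]
    simp
  obtain ⟨u, -, hu⟩ := hF.exists_word (by exact_mod_cast hq)
  exact ⟨u, fun n => by exact_mod_cast hu n⟩

section Stretch

variable {q k : ℕ} (u : ℕ → Fin q)

theorem complexity_le_complexity_stretch (hk : 0 < k) (n : ℕ) :
    complexity u n ≤ complexity (fun i => u (i / k)) (k * n) := by
  have hsub : factors u n ⊆ (fun (v : Fin (k * n) → Fin q) (j : Fin n) =>
      v ⟨k * j, Nat.mul_lt_mul_of_pos_left j.2 hk⟩) '' factors (fun i => u (i / k)) (k * n) := by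
    rintro _ ⟨i, rfl⟩
    refine ⟨_, ⟨k * i, rfl⟩, ?_⟩
    funext j
    simp only
    rw [← mul_add, Nat.mul_div_cancel_left _ hk]
  exact (Set.ncard_le_ncard hsub (Set.toFinite _)).trans (Set.ncard_image_le (Set.toFinite _))

/-- A window of length `k * n` is determined by its phase modulo `k` and the at most `n + 1` blocks
that it meets. -/
theorem complexity_stretch_le (hk : 0 < k) (n : ℕ) :
    complexity (fun i => u (i / k)) (k * n) ≤ k * q ^ (n + 1) := by
  have hlt : ∀ (r : Fin k) (j : Fin (k * n)), ((r : ℕ) + j) / k < n + 1 := by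
    intro r j
    rw [Nat.div_lt_iff_lt_mul hk]
    have := r.2
    have := j.2
    nlinarith
  have hsub : factors (fun i => u (i / k)) (k * n) ⊆
      (fun (p : Fin k × (Fin (n + 1) → Fin q)) (j : Fin (k * n)) => p.2 ⟨_, hlt p.1 j⟩) ''
        Set.univ := by
    rintro _ ⟨i, rfl⟩
    refine ⟨(⟨i % k, Nat.mod_lt i hk⟩, fun j => u (i / k + j)), trivial, ?_⟩
    funext j
    simp only
    congr 1
    conv_rhs => rw [← Nat.div_add_mod i k, add_assoc, Nat.mul_add_div hk]
  refine (Set.ncard_le_ncard hsub (Set.toFinite _)).trans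
    ((Set.ncard_image_le (Set.toFinite _)).trans ?_)
  rw [Set.ncard_univ]
  simp

end Stretch

/-- The entropies of the infinite words are dense in the half-line. -/
theorem exists_entropy_near {h ε : ℝ} (hh : 0 < h) (hε : 0 < ε) :
    ∃ (q : ℕ) (w : ℕ → Fin q), h ≤ entropy w ∧ entropy w ≤ h + ε := by
  -- The stretched word has entropy `log q / k`. Rounding `exp (k * h)` up to `q` costs at most a
  -- factor 2, that is `log 2 / k < ε` in entropy.
  obtain ⟨k, hkε⟩ := exists_nat_gt (Real.log 2 / ε)
  have hk' : (0 : ℝ) < k := (div_pos (Real.log_pos one_lt_two) hε).trans hkε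
  have hk : 0 < k := by exact_mod_cast hk'
  rw [div_lt_iff₀ hε] at hkε
  set q := ⌈Real.exp (k * h)⌉₊ with hq
  have hqle : Real.exp (k * h) ≤ q := Nat.le_ceil _
  have hq0 : (0 : ℝ) < q := (Real.exp_pos _).trans_le hqle
  have hqlt : (q : ℝ) ≤ Real.exp (k * (h + ε)) := by
    have h1 : (1 : ℝ) ≤ Real.exp (k * h) := Real.one_le_exp (by positivity)
    have h2 := Nat.ceil_lt_add_one (Real.exp_pos (k * h)).le
    calc (q : ℝ) ≤ Real.exp (Real.log 2) * Real.exp (k * h) := by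
          rw [Real.exp_log two_pos]
          linarith
      _ = Real.exp (Real.log 2 + k * h) := (Real.exp_add _ _).symm
      _ ≤ Real.exp (k * (h + ε)) := Real.exp_le_exp.2 (by linarith)
  obtain ⟨u, hu⟩ := exists_pow_le_complexity (q := q) (by exact_mod_cast hq0)
  refine ⟨q, fun i => u (i / k), ?_, ?_⟩
  · have hlim := (tendsto_entropy fun i => u (i / k)).comp
      (Filter.tendsto_id.const_mul_atTop' hk)
    refine ge_of_tendsto hlim ?_
    filter_upwards [Filter.eventually_gt_atTop 0] with n hn
    have hn' : (0 : ℝ) < n := by exact_mod_cast hn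
    simp only [Function.comp_apply, id_eq, Nat.cast_mul]
    rw [le_div_iff₀ (by positivity),
      Real.le_log_iff_exp_le (by exact_mod_cast complexity_pos _ _)]
    calc Real.exp (h * (k * n)) = Real.exp (k * h) ^ n := by
          rw [← Real.exp_nat_mul]
          ring_nf
      _ ≤ (q : ℝ) ^ n := by gcongr
      _ ≤ _ := by exact_mod_cast (hu n).trans (complexity_le_complexity_stretch u hk n)
  · set E := entropy fun i => u (i / k)
    have hE : Real.exp (k * E) ≤ q := by
      by_contra! hlt
      obtain ⟨n, hn⟩ := pow_unbounded_of_one_lt ((k : ℝ) * q) ((one_lt_div hq0).2 hlt)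
      rw [div_pow, lt_div_iff₀ (by positivity)] at hn
      have h1 := (exp_entropy_pow_le_complexity (fun i => u (i / k)) (k * n)).trans
        (Nat.cast_le.2 (complexity_stretch_le u hk n))
      rw [pow_mul, ← Real.exp_nat_mul] at h1
      push_cast at h1
      rw [pow_succ] at h1
      nlinarith
    have := Real.exp_le_exp.1 (hE.trans hqlt)
    exact le_of_mul_le_mul_left this hk'

/-! ### The two properties and the realizing word. -/

theorem wordEntropy_nonneg {f : ℕ → ℝ≥0} (hf : ∀ n, 1 ≤ f n) : 0 ≤ wordEntropy f := by
  let w : ℕ → Fin 1 := fun _ => 0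
  have hw : ∀ n, complexity w n = 1 := fun n => by
    rw [complexity, Set.ncard_eq_one]
    exact ⟨fun _ => 0, Set.Subset.antisymm (fun _ _ => Subsingleton.elim _ _)
      fun x _ => ⟨0, Subsingleton.elim _ _⟩⟩
  refine le_trans ?_ (entropy_le_wordEntropy (w := w) fun n => ?_)
  · exact_mod_cast entropy_nonneg w
  · rw [hw]
    exact_mod_cast hf n

theorem CStar.one_le {f : ℕ → ℝ≥0} (hf : CStar f) (n : ℕ) : 1 ≤ f n :=
  le_trans (by simp) (hf.succ_le n)

theorem PropertyTwo.propertyOne (H : PropertyTwo) : PropertyOne := by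
  intro f g hf hg
  refine le_antisymm (le_min (wordEntropy_mono fun n => min_le_left _ _)
    (wordEntropy_mono fun n => min_le_right _ _)) ?_
  refine EReal.ge_of_forall_gt_iff_ge.1 fun h hh => ?_
  have hfh := (lt_min_iff.1 hh).1.le
  have hgh := (lt_min_iff.1 hh).2.le
  -- (P₂) says nothing for `h ≤ 0`; there a constant word suffices.
  rcases le_or_gt h 0 with h0 | h0
  · exact le_trans (by exact_mod_cast h0)
      (wordEntropy_nonneg fun n => le_min (hf.one_le n) (hg.one_le n))
  · obtain ⟨f₀, hf₀⟩ := H h h0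
    rw [← hf₀.entropy_eq]
    refine wordEntropy_le fun q w hw => entropy_le_wordEntropy fun n => ?_
    rcases Nat.eq_zero_or_pos n with rfl | hn
    · rw [complexity_zero]
      exact_mod_cast le_min (hf.one_le 0) (hg.one_le 0)
    · exact (hw n).trans (le_min (hf₀.le f hfh n hn) (hf₀.le g hgh n hn))

/-- The least number of factors of length `n` of a word of entropy at least `h`. -/
noncomputable def leastComplexity (h : ℝ) (n : ℕ) : ℕ :=
  sInf {c | ∃ (q : ℕ) (w : ℕ → Fin q), h ≤ entropy w ∧ complexity w n = c}

theorem leastComplexity_le {h : ℝ} {q : ℕ} {w : ℕ → Fin q} (hw : h ≤ entropy w) (n : ℕ) :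
    leastComplexity h n ≤ complexity w n :=
  Nat.sInf_le ⟨q, w, hw, rfl⟩

theorem exists_complexity_eq_leastComplexity {h : ℝ} (hh : 0 < h) (n : ℕ) :
    ∃ (q : ℕ) (w : ℕ → Fin q), h ≤ entropy w ∧ complexity w n = leastComplexity h n := by
  obtain ⟨q, w, hw, -⟩ := exists_entropy_near hh one_pos
  exact Nat.sInf_mem (s := {c | ∃ (q : ℕ) (w : ℕ → Fin q), h ≤ entropy w ∧ complexity w n = c})
    ⟨_, q, w, hw, rfl⟩

/-- (P₁) merges a word optimal up to `N` with one optimal at `N + 1`: the minimum of their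
complexities still has word entropy at least `h`, and this is attained by a word. -/
theorem PropertyOne.exists_complexity_le (H : PropertyOne) {h : ℝ} (hh : 0 < h) (N : ℕ) :
    ∃ (q : ℕ) (w : ℕ → Fin q), h ≤ entropy w ∧
      ∀ n ≤ N, complexity w n ≤ leastComplexity h n := by
  induction N with
  | zero =>
    obtain ⟨q, w, hw, hw0⟩ := exists_complexity_eq_leastComplexity hh 0
    exact ⟨q, w, hw, fun n hn => (Nat.le_zero.1 hn) ▸ hw0.le⟩
  | succ N ih =>
    obtain ⟨q, w, hw, hwN⟩ := ih
    obtain ⟨q', w', hw', hwN'⟩ := exists_complexity_eq_leastComplexity hh (N + 1)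
    have hle : (h : EReal) ≤
        wordEntropy fun n => min (complexity w n : ℝ≥0) (complexity w' n : ℝ≥0) := by
      rw [H _ _ (cstar_complexity w (hh.trans_le hw)) (cstar_complexity w' (hh.trans_le hw'))]
      exact le_min
        ((EReal.coe_le_coe_iff.2 hw).trans (entropy_le_wordEntropy fun _ => le_rfl))
        ((EReal.coe_le_coe_iff.2 hw').trans (entropy_le_wordEntropy fun _ => le_rfl))
    obtain ⟨p, z, hz, hzh⟩ := exists_mem_boundedWords_of_le_wordEntropy hle
    refine ⟨p, z, hzh, fun n hn => ?_⟩
    have hzn : complexity z n ≤ complexity w n ∧ complexity z n ≤ complexity w' n := by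
      exact_mod_cast le_min_iff.1 (hz n)
    rcases Nat.le_succ_iff.1 hn with hn | rfl
    · exact hzn.1.trans (hwN n hn)
    · exact hzn.2.trans hwN'.le

theorem PropertyOne.propertyTwo (H : PropertyOne) : PropertyTwo := by
  intro h hh
  obtain ⟨q, w, hw, hwh⟩ :=
      exists_mem_boundedWords_of_forall (f := fun n => (leastComplexity h n : ℝ≥0)) (h := h)
        fun N => by
    obtain ⟨q, w, hw, hwN⟩ := H.exists_complexity_le hh N
    refine ⟨q, w, fun n hn => by exact_mod_cast hwN n hn, le_trans ?_ hw⟩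
    have : (0 : ℝ) < 1 / ((N : ℝ) + 1) := by positivity
    linarith
  have hle : ∀ n, complexity w n ≤ leastComplexity h n := fun n => Nat.cast_le.1 (hw n)
  refine ⟨fun n => (complexity w n : ℝ≥0), cstar_complexity w (hh.trans_le hwh), ?_, ?_⟩
  · refine le_antisymm (wordEntropy_le fun p z hz => ?_)
      ((EReal.coe_le_coe_iff.2 hwh).trans (entropy_le_wordEntropy fun _ => le_rfl))
    refine EReal.coe_le_coe_iff.2 (le_of_forall_pos_le_add fun ε hε => ?_)
    -- A word of entropy in `[h, h + ε]` dominates `leastComplexity h`, hence `p_z`.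
    obtain ⟨p', z', hz', hε'⟩ := exists_entropy_near hh hε
    refine le_trans (entropy_mono fun n => ?_) hε'
    have hzw : complexity z n ≤ complexity w n := Nat.cast_le.1 (hz n)
    exact hzw.trans ((hle n).trans (leastComplexity_le hz' n))
  · intro f hf n _
    obtain ⟨p, z, hz, hzh⟩ := exists_mem_boundedWords_of_le_wordEntropy hf
    exact (Nat.cast_le.2 ((hle n).trans (leastComplexity_le hzh n))).trans (hz n)

/-- For a word `w` attaining the entropy of `f₀`, leastness applied to `p_w` itself gives `f₀ ≤ p_w
≤ f₀` at positive lengths. -/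
theorem IsLeastOfEntropy.exists_word {h : ℝ} {f₀ : ℕ → ℝ≥0} (hf₀ : IsLeastOfEntropy h f₀) :
    ∃ (q : ℕ) (w : ℕ → Fin q), ∀ n : ℕ, 1 ≤ n → (complexity w n : ℝ≥0) = f₀ n := by
  obtain ⟨q, w, hw, hwh⟩ := exists_mem_boundedWords_of_le_wordEntropy hf₀.entropy_eq.ge
  refine ⟨q, w, fun n hn => le_antisymm (hw n) ?_⟩
  exact hf₀.le (fun n => (complexity w n : ℝ≥0))
    ((EReal.coe_le_coe_iff.2 hwh).trans (entropy_le_wordEntropy fun _ => le_rfl)) n hn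

end WordEntropy

theorem proposition9p2 :
    (WordEntropy.PropertyOne ↔ WordEntropy.PropertyTwo) ∧
    (WordEntropy.PropertyOne ∨ WordEntropy.PropertyTwo →
      ∀ h : ℝ, 0 < h → ∀ f₀ : ℕ → ℝ≥0, WordEntropy.IsLeastOfEntropy h f₀ →
        ∃ (q : ℕ) (w : ℕ → Fin q),
          ∀ n : ℕ, 1 ≤ n → (WordEntropy.complexity w n : ℝ≥0) = f₀ n) :=
  ⟨⟨fun H => H.propertyTwo, fun H => H.propertyOne⟩, fun _ _ _ _ hf₀ => hf₀.exists_word⟩
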